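/- Let $M$ be a smooth (finite-dimensional, Hausdorff) manifold and $E\to M$ a smooth real vector bundle of finite rank $\ge 1$. **The omni-Lie algebroid.** Let $\mathfrak{D}E$ be the gauge Lie algebroid of $E$: its sections are the $\mathbb{R}$-linear operators $\mathfrak d:\Gamma(E)\to\Gamma(E)$ with $\mathfrak d(fu)=f\,\mathfrak d u+\alpha(\mathfrak d)(f)\,u$ for a vector field $\alpha(\mathfrak d)$ on $M$ (the anchor), with the commutator bracket. Let $\mathfrak{J}E$ be the first jet bundle of $E$, identified through the $E$-valued pairing $\langle [u]_m,\mathfrak d\rangle_E=(\mathfrak d u)(m)$ with $$\{\nu\in\mathrm{Hom}(\mathfrak{D}E,E)\;:\;\nu(\Phi)=\Phi\circ\nu(1_E)\ \text{ for all }\Phi\in\mathfrak{gl}(E)\},$$ and let $\mathbb{d}:\Gamma(E)\to\Gamma(\mathfrak{J}E)$, $u\mapsto [u]$, be the jet map. For $\mathfrak d\in\Gamma(\mathfrak{D}E)$ and $\nu\in\Gamma(\mathfrak{J}E)$ the Lie derivative $\mathfrak{L}_{\mathfrak d}\nu\in\Gamma(\mathfrak{J}E)$ is defined by $\langle\mathfrak{L}_{\mathfrak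 d}\nu,\mathfrak d'\rangle_E=\mathfrak d\langle\nu,\mathfrak d'\rangle_E-\langle\nu,[\mathfrak d,\mathfrak d']\rangle_E$ for all $\mathfrak d'\in\Gamma(\mathfrak{D}E)$. The omni-Lie algebroid is $\mathcal{E}=\mathfrak{D}E\oplus\mathfrak{J}E$ with the symmetric $E$-valued pairing $$\langle\mathfrak d+\mu,\mathfrak r+\nu\rangle_E=\tfrac12\big(\langle\mathfrak d,\nu\rangle_E+\langle\mathfrak r,\mu\rangle_E\big)$$ and the bracket on $\Gamma(\mathcal{E})$ $$\{\mathfrak d+\mu,\mathfrak r+\nu\}=[\mathfrak d,\mathfrak r]+\mathfrak{L}_{\mathfrak d}\nu-\mathfrak{L}_{\mathfrak r}\mu+\mathbb{d}\langle\mu,\mathfrak r\rangle_E .$$ **Dirac structures.** A Dirac structure is a smooth vector subbundle $L\subset\mathcal{E}$ each of whose fibres $L_m$ is maximal among the subspaces of $\mathcal{E}_m$ that are isotropic for $\langle\cdot,\cdot\rangle_E$, and such that $\{\Gamma(L),\Gamma(L)\}\subset\Gamma(L)$. Its normalizer is $$N_L=\{X\in\Gamma(\mathcal{E})\;:\;\{X,Y\}\in\Gamma(L)\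 \text{ for all }Y\in\Gamma(L)\}.$$ A Dirac structure $L$ is a Lie algebroid with bracket $\{\cdot,\cdot\}$, and the projection $\rho_L:L\to\mathfrak{D}E$ is a representation of $L$ on $E$. The corresponding coboundary $d_L:\Omega^1(L,E)\to\Omega^2(L,E)$ is $$(d_L\eta)(l_1,l_2)=\rho_L(l_1)\,\eta(l_2)-\rho_L(l_2)\,\eta(l_1)-\eta(\{l_1,l_2\}),\qquad l_1,l_2\in\Gamma(L).$$ **Proposition.** Let $L\subset\mathcal{E}$ be a Dirac structure, let $X\in\Gamma(\mathcal{E})$, and let $\omega_X\in\Omega^1(L,E)$ be the $1$-cochain $\omega_X(l)=\langle X,l\rangle_E$. Then $$(d_L\omega_X)(l_1,l_2)=-\langle\{X,l_1\},l_2\rangle_E\qquad\text{for all }l_1,l_2\in\Gamma(L),$$ and $X\in N_L$ if and only if $d_L\omega_X=0$. -/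

import Mathlib

open Bundle Filter Topology
open scoped Manifold ContDiff

noncomputable section

set_option linter.unusedSectionVars false

namespace OmniLie

variable (EM : Type*) [NormedAddCommGroup EM] [NormedSpace ℝ EM]
  {M : Type*} [TopologicalSpace M] [ChartedSpace EM M] [IsManifold 𝓘(ℝ, EM) ∞ M]
  (F : Type*) [NormedAddCommGroup F] [NormedSpace ℝ F]
  (E : M → Type*) [TopologicalSpace (TotalSpace F E)] [∀ m, AddCommGroup (E m)]
  [∀ m, Module ℝ (E m)] [∀ m, TopologicalSpace (E m)] [FiberBundle F E] [VectorBundle ℝ F E]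

variable (M) in
/-- The algebra `C^∞(M)` of smooth real functions on `M`. -/
abbrev SmoothFun := C^∞⟮𝓘(ℝ, EM), M; ℝ⟯

/-- The space `Γ(E)` of global smooth sections of `E`. -/
abbrev Sec := Cₛ^∞⟮𝓘(ℝ, EM); F, E⟯

variable (M) in
/-- Smooth vector fields on `M`. -/
abbrev VecField := Cₛ^∞⟮𝓘(ℝ, EM); EM, (TangentSpace 𝓘(ℝ, EM) : M → Type _)⟯

variable {EM F E}

instance : AddCommGroup (Sec EM F E) := inferInstance

instance : Module ℝ (Sec EM F E) := inferInstance

/-- Pointwise multiplication of a smooth section by a smooth function. -/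
instance Sec.instSMul : SMul (SmoothFun EM M) (Sec EM F E) :=
  ⟨fun f u => ⟨fun m => f m • u m, f.contMDiff.smul_section u.contMDiff⟩⟩

theorem Sec.smul_apply (f : SmoothFun EM M) (u : Sec EM F E) (m : M) :
    (f • u) m = f m • u m := rfl

/-- `Γ(E)` is a module over `C^∞(M)`. -/
instance Sec.instModule : Module (SmoothFun EM M) (Sec EM F E) where
  one_smul u := by ext m; exact one_smul ℝ (u m)
  mul_smul f g u := by ext m; exact mul_smul (f m) (g m) (u m)
  smul_zero f := by ext m; exact smul_zero (f m)
  smul_add f u v := by ext m; exact smul_add (f m) (u m) (v m)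
  add_smul f g u := by ext m; exact add_smul (f m) (g m) (u m)
  zero_smul u := by ext m; exact zero_smul ℝ (u m)

instance Sec.instTower : IsScalarTower ℝ (SmoothFun EM M) (Sec EM F E) where
  smul_assoc r f u := by ext m; exact smul_assoc r (f m) (u m)

/-- The space of all (not necessarily smooth) sections of a family of vector spaces. -/
def AllSec (EM : Type*) [NormedAddCommGroup EM] [NormedSpace ℝ EM]
  {M : Type*} [TopologicalSpace M] [ChartedSpace EM M] (V : M → Type*) := ∀ m : M, V m

section AllSec
variable {V : M → Type*} [∀ m, AddCommGroup (V m)] [∀ m, Module ℝ (V m)]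

instance : AddCommGroup (AllSec EM V) := inferInstanceAs (AddCommGroup (∀ m : M, V m))
instance : Module ℝ (AllSec EM V) := inferInstanceAs (Module ℝ (∀ m : M, V m))

/-- Sections of a family of vector spaces form a `C^∞(M)`-module under pointwise operations. -/
instance : Module (SmoothFun EM M) (AllSec EM V) where
  smul f s := fun m => f m • s m
  one_smul u := by funext m; exact one_smul ℝ (u m)
  mul_smul f g u := by funext m; exact mul_smul (f m) (g m) (u m)
  smul_zero f := by funext m; exact smul_zero (f m)
  smul_add f u v := by funext m; exact smul_add (f m) (u m) (v m)
  add_smul f g u := by funext m; exact add_smul (f m) (g m) (u m)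
  zero_smul u := by funext m; exact zero_smul ℝ (u m)

instance : IsScalarTower ℝ (SmoothFun EM M) (AllSec EM V) where
  smul_assoc r f u := by funext m; exact smul_assoc r (f m) (u m)
end AllSec

/-- The derivative `x(f)` of `f` along a tangent vector `x` at `m`. -/
def tder (f : SmoothFun EM M) (m : M) : TangentSpace 𝓘(ℝ, EM) m →ₗ[ℝ] ℝ :=
  (mvfderiv 𝓘(ℝ, EM) f m).toLinearMap

theorem SmoothFun.mdiff (f : SmoothFun EM M) (m : M) :
    MDifferentiableAt 𝓘(ℝ, EM) 𝓘(ℝ, ℝ) f m :=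
  f.contMDiff.mdifferentiable (by simp) m

theorem tder_mul (f g : SmoothFun EM M) (m : M) (x : TangentSpace 𝓘(ℝ, EM) m) :
    tder (f * g) m x = f m * tder g m x + g m * tder f m x := by
  have := mvfderiv_mul (f.mdiff m) (g.mdiff m)
  have h2 := DFunLike.congr_fun this x
  simpa [tder] using h2

theorem tder_add (f g : SmoothFun EM M) (m : M) (x : TangentSpace 𝓘(ℝ, EM) m) :
    tder (f + g) m x = tder f m x + tder g m x := by
  have := mvfderiv_add (f.mdiff m) (g.mdiff m)
  have h2 := DFunLike.congr_fun this x
  simpa [tder] using h2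

theorem tder_smul (r : ℝ) (f : SmoothFun EM M) (m : M) (x : TangentSpace 𝓘(ℝ, EM) m) :
    tder (r • f) m x = r * tder f m x := by
  have h := mvfderiv_smul (𝕜 := ℝ) (a := fun _ : M => r) (mdifferentiableAt_const) (f.mdiff m)
  have h3 : mvfderiv 𝓘(ℝ, EM) (fun _ : M => r) m = 0 := mvfderiv_const r
  change mvfderiv 𝓘(ℝ, EM) ((fun _ : M => r) • (f : M → ℝ)) m x = _
  rw [h, h3]
  simp [tder]

theorem tder_congr {f g : SmoothFun EM M} {m : M} (h : (f : M → ℝ) =ᶠ[𝓝 m] g) :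
    tder f m = tder g m := by
  have h1 : mfderiv 𝓘(ℝ, EM) 𝓘(ℝ, ℝ) f m = mfderiv 𝓘(ℝ, EM) 𝓘(ℝ, ℝ) g m := h.mfderiv_eq
  ext x
  exact congrArg (fun A => (A x : ℝ)) h1

theorem contMDiff_tder (x : VecField EM M) (f : SmoothFun EM M) :
    ContMDiff 𝓘(ℝ, EM) 𝓘(ℝ, ℝ) ∞ (fun m => tder f m (x m)) := by
  have h1 : ContMDiff 𝓘(ℝ, EM).tangent 𝓘(ℝ, ℝ).tangent ∞ (tangentMap 𝓘(ℝ, EM) 𝓘(ℝ, ℝ) f) :=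
    f.contMDiff.contMDiff_tangentMap le_rfl
  have h2 := h1.comp x.contMDiff
  have h3 := (contMDiff_snd_tangentBundle_modelSpace ℝ 𝓘(ℝ, ℝ) (n := ∞)).comp h2
  exact h3

/-- Action of a vector field on a smooth function. -/
def VecField.app (x : VecField EM M) (f : SmoothFun EM M) : SmoothFun EM M :=
  ⟨fun m => tder f m (x m), contMDiff_tder x f⟩

variable [FiniteDimensional ℝ EM]

instance : ContMDiffVectorBundle ∞ EM (TangentSpace 𝓘(ℝ, EM) : M → Type _) 𝓘(ℝ, EM) := inferInstance

theorem isManifold_min : IsManifold 𝓘(ℝ, EM) (minSmoothness ℝ 2) M ∧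
    IsManifold 𝓘(ℝ, EM) (minSmoothness ℝ 3) M ∧ IsManifold 𝓘(ℝ, EM) ((∞ : ℕ∞ω) + 1) M := by
  refine ⟨?_, ?_, ?_⟩
  · rw [minSmoothness_of_isRCLikeNormedField]; infer_instance
  · rw [minSmoothness_of_isRCLikeNormedField]; infer_instance
  · assumption

/-- The Lie bracket of smooth vector fields. -/
def VecField.bracket (x y : VecField EM M) : VecField EM M :=
  ⟨VectorField.mlieBracket 𝓘(ℝ, EM) x y, by
    obtain ⟨h1, -, h3⟩ := isManifold_min (EM := EM) (M := M)
    refine ContDiff.mlieBracket_vectorField (m := ⊤) (n := ⊤) x.contMDiff y.contMDiff ?_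
    rw [minSmoothness_of_isRCLikeNormedField]
    exact le_rfl⟩

theorem VecField.bracket_swap (x y : VecField EM M) : x.bracket y = - y.bracket x := by
  ext m
  exact VectorField.mlieBracket_swap_apply

theorem VecField.bracket_self (x : VecField EM M) : x.bracket x = 0 := by
  ext m
  exact congrFun VectorField.mlieBracket_self m

theorem VecField.bracket_zero (x : VecField EM M) : x.bracket 0 = 0 := by
  ext m
  exact congrFun VectorField.mlieBracket_zero_right m

theorem VecField.bracket_add (x y z : VecField EM M) :
    x.bracket (y + z) = x.bracket y + x.bracket z := by
  obtain ⟨h1, -, -⟩ := isManifold_min (EM := EM) (M := M)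
  ext m
  exact VectorField.mlieBracket_add_right y.mdifferentiableAt z.mdifferentiableAt

theorem VecField.bracket_smul (x : VecField EM M) (f : SmoothFun EM M) (y : VecField EM M) :
    x.bracket (f • y) = x.app f • y + f • x.bracket y := by
  obtain ⟨h1, -, -⟩ := isManifold_min (EM := EM) (M := M)
  ext m
  exact VectorField.mlieBracket_smul_right (f.mdiff m) y.mdifferentiableAt

theorem VecField.jacobi (x y z : VecField EM M) :
    x.bracket (y.bracket z) = (x.bracket y).bracket z + y.bracket (x.bracket z) := by
  obtain ⟨h1, h2, -⟩ := isManifold_min (EM := EM) (M := M)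
  have h (w : VecField EM M) : ContMDiff 𝓘(ℝ, EM) 𝓘(ℝ, EM).tangent (minSmoothness ℝ 2)
      (fun m => (⟨m, w m⟩ : TangentBundle 𝓘(ℝ, EM) M)) := by
    rw [minSmoothness_of_isRCLikeNormedField]
    exact w.contMDiff.of_le (by norm_cast)
  ext m
  exact VectorField.leibniz_identity_mlieBracket_apply (h x m) (h y m) (h z m)

section Frames

variable [T2Space M] [FiniteDimensional ℝ F] [ContMDiffVectorBundle ∞ F E 𝓘(ℝ, EM)]

theorem exists_bump {m : M} {U : Set M} (hU : U ∈ 𝓝 m) :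
    ∃ f : SmoothFun EM M, tsupport f ⊆ U ∧ (f : M → ℝ) =ᶠ[𝓝 m] 1 := by
  obtain ⟨χ, -, h⟩ := (SmoothBumpFunction.nhds_basis_tsupport (I := 𝓘(ℝ, EM)) m).mem_iff.1 hU
  exact ⟨⟨χ, χ.contMDiff⟩, h, χ.eventuallyEq_one⟩

theorem Sec.sum_apply {ι : Type*} (t : Finset ι) (s : ι → Sec EM F E) (m : M) :
    (∑ i ∈ t, s i) m = ∑ i ∈ t, s i m :=
  map_sum ((Pi.evalAddMonoidHom E m).comp (ContMDiffSection.coeAddHom 𝓘(ℝ, EM) F ∞ E)) s t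

variable (EM F E) in
theorem exists_frame (m : M) : ∃ (k : ℕ) (s : Fin k → Sec EM F E)
    (c : Fin k → ∀ p : M, E p →ₗ[ℝ] ℝ),
    (∀ i (u : Sec EM F E), ContMDiff 𝓘(ℝ, EM) 𝓘(ℝ, ℝ) ∞ (fun p => c i p (u p))) ∧
    ∀ᶠ p in 𝓝 m, ∀ v : E p, v = ∑ i, c i p v • s i p := by
  have : ContMDiffVectorBundle 1 F E 𝓘(ℝ, EM) := ContMDiffVectorBundle.of_le (n := ∞) (by simp)
  let e := trivializationAt F E m
  let b := Module.finBasis ℝ F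
  have hm : e.baseSet ∈ 𝓝 m :=
    e.open_baseSet.mem_nhds (FiberBundle.mem_baseSet_trivializationAt F E m)
  obtain ⟨χ, hχ, hχ1⟩ := exists_bump (EM := EM) hm
  refine ⟨_, fun i => ⟨(χ : M → ℝ) • e.localFrame b i, ?_⟩,
    fun i p => χ p • e.localFrameCoeff 𝓘(ℝ, EM) b i p, ?_, ?_⟩
  · exact ContMDiffOn.smul_section_of_tsupport χ.contMDiff.contMDiffOn e.open_baseSet hχ
      (e.contMDiffOn_localFrame_baseSet ∞ b i)
  · intro i u
    refine contMDiff_of_tsupport fun p hp => ?_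
    have hp' : p ∈ e.baseSet := hχ (closure_mono (fun q hq => by
      simp only [Function.mem_support] at hq ⊢
      intro h0
      exact hq (by simp [h0])) hp)
    exact (χ.contMDiff p).smul (contMDiffAt_localFrameCoeff b hp' (u.contMDiff p) i)
  · classical
    filter_upwards [hm, hχ1] with p hp h1 v
    have h2 := e.eq_sum_localFrameCoeff_smul (I := 𝓘(ℝ, EM)) (b := b)
      (s := Function.update (0 : ∀ q, E q) p v) hp
    have h1' : χ p = 1 := h1
    simpa [h1'] using h2

/-- Every vector in a fibre is the value of a global smooth section. -/
theorem exists_sec (m : M) (v : E m) : ∃ u : Sec EM F E, u m = v := by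
  obtain ⟨k, s, c, -, h⟩ := exists_frame EM F E m
  refine ⟨∑ i, c i m v • s i, ?_⟩
  rw [Sec.sum_apply]
  exact (h.self_of_nhds v).symm

end Frames

/-- `[x, y](f) = x(y(f)) - y(x(f))`. -/
theorem VecField.bracket_app [T2Space M] (x y : VecField EM M) (f : SmoothFun EM M) :
    (x.bracket y).app f = x.app (y.app f) - y.app (x.app f) := by
  ext m
  by_cases hEM : Subsingleton EM
  · have (g : SmoothFun EM M) (v : TangentSpace 𝓘(ℝ, EM) m) : tder g m v = 0 := by
      rw [show v = 0 from hEM.elim _ _, map_zero]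
    change tder _ _ _ = tder _ _ _ - tder _ _ _
    simp [this]
  · rw [not_subsingleton_iff_nontrivial] at hEM
    obtain ⟨v, hv⟩ := exists_ne (0 : EM)
    obtain ⟨u, hu⟩ := exists_sec (EM := EM) (F := EM)
      (E := (TangentSpace 𝓘(ℝ, EM) : M → Type _)) m v
    have h1 := VecField.jacobi x y (f • u)
    have h2 := VecField.jacobi x y u
    simp only [VecField.bracket_smul, VecField.bracket_add, smul_add, h2] at h1
    have h3 : ((x.bracket y).app f - (x.app (y.app f) - y.app (x.app f))) • u = 0 := by
      rw [← sub_eq_zero] at h1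
      rw [← neg_eq_zero, ← h1]
      module
    have h4 : ((x.bracket y).app f m - (x.app (y.app f) m - y.app (x.app f) m)) • u m = 0 :=
      DFunLike.congr_fun h3 m
    rcases smul_eq_zero.1 h4 with h | h
    · exact sub_eq_zero.1 h
    · exact absurd (hu.symm.trans h) hv

/-! ### The gauge Lie algebroid -/

variable (EM F E) in
/-- The fibre at `m` of the gauge Lie algebroid `𝔇E`: derivations of `E` at `m`, that is, pairs
`(d, x)` of a linear map `d : Γ(E) → E_m` and its symbol `x ∈ T_m M`, such that
`d (f u) = f(m) d u + x(f) u(m)`. -/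
def derivSubmodule (m : M) : Submodule ℝ ((Sec EM F E →ₗ[ℝ] E m) × TangentSpace 𝓘(ℝ, EM) m) where
  carrier := {d | ∀ (f : SmoothFun EM M) (u : Sec EM F E),
    d.1 (f • u) = f m • d.1 u + tder f m d.2 • u m}
  zero_mem' f u := by simp
  add_mem' {d d'} hd hd' f u := by
    simp only [Prod.fst_add, Prod.snd_add, LinearMap.add_apply, map_add, hd f u, hd' f u]
    module
  smul_mem' r d hd f u := by
    simp only [Prod.smul_fst, Prod.smul_snd, LinearMap.smul_apply, map_smul, hd f u, smul_eq_mul]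
    module

variable (EM F E) in
/-- The fibre `(𝔇E)_m`, as a type. -/
abbrev DFib (m : M) : Type _ := derivSubmodule EM F E m

instance (m : M) : AddCommGroup (DFib EM F E m) := inferInstance

instance (m : M) : Module ℝ (DFib EM F E m) := inferInstance

/-- The value `d u` of a derivation `d` at `m` on a section `u`. -/
def DFib.app {m : M} (d : DFib EM F E m) (u : Sec EM F E) : E m := d.1.1 u

/-- The anchor `α : 𝔇E → TM` on the fibre at `m`. -/
def DFib.symbol {m : M} (d : DFib EM F E m) : TangentSpace 𝓘(ℝ, EM) m := d.1.2

theorem DFib.leibniz {m : M} (d : DFib EM F E m) (f : SmoothFun EM M) (u : Sec EM F E) :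
    d.app (f • u) = f m • d.app u + tder f m d.symbol • u m := d.2 f u

@[ext]
theorem DFib.ext {m : M} {d d' : DFib EM F E m} (h : ∀ u, d.app u = d'.app u)
    (h' : d.symbol = d'.symbol) : d = d' :=
  Subtype.ext (Prod.ext (LinearMap.ext h) h')

/-- The inclusion of `gl(E_m)` into the fibre of `𝔇E` at `m`, `Φ ↦ (u ↦ Φ (u m))`. -/
def glIncl (m : M) : (E m →ₗ[ℝ] E m) →ₗ[ℝ] DFib EM F E m where
  toFun Φ := ⟨({ toFun := fun u => Φ (u m)
                 map_add' := fun u v => map_add Φ (u m) (v m)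
                 map_smul' := fun r u => map_smul Φ r (u m) }, 0), fun f u => by
    simp [Sec.smul_apply]⟩
  map_add' Φ Ψ := by ext u <;> simp [DFib.app, DFib.symbol]
  map_smul' r Φ := by ext u <;> simp [DFib.app, DFib.symbol]

variable (EM F E) in
/-- `Γ(𝔇E)`: a section of `𝔇E` is smooth iff its symbol is a smooth vector field and it maps
smooth sections of `E` to smooth sections of `E`. -/
def gammaDSubmodule : Submodule (SmoothFun EM M) (AllSec EM fun m : M => DFib EM F E m) where
  carrier := {δ | (∀ u : Sec EM F E, ContMDiff 𝓘(ℝ, EM) (𝓘(ℝ, EM).prod 𝓘(ℝ, F)) ∞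
      fun m => TotalSpace.mk' F m ((δ m).app u)) ∧
    ContMDiff 𝓘(ℝ, EM) 𝓘(ℝ, EM).tangent ∞
      fun m => (⟨m, (δ m).symbol⟩ : TangentBundle 𝓘(ℝ, EM) M)}
  zero_mem' := ⟨fun _ => (0 : Sec EM F E).contMDiff, (0 : VecField EM M).contMDiff⟩
  add_mem' h h' := ⟨fun u => (h.1 u).add_section (h'.1 u), h.2.add_section h'.2⟩
  smul_mem' f _ h := ⟨fun u => f.contMDiff.smul_section (h.1 u), f.contMDiff.smul_section h.2⟩

variable (EM F E) in
/-- The space `Γ(𝔇E)`, as a type. -/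
abbrev GammaD : Type _ := gammaDSubmodule EM F E

instance : AddCommGroup (GammaD EM F E) := inferInstance

instance : Module (SmoothFun EM M) (GammaD EM F E) := inferInstance

namespace GammaD

/-- The operator `u ↦ δ u` on `Γ(E)` defined by a section `δ` of `𝔇E`. -/
def op (δ : GammaD EM F E) : Sec EM F E →ₗ[ℝ] Sec EM F E where
  toFun u := ⟨fun m => (δ.1 m).app u, δ.2.1 u⟩
  map_add' u v := by ext m; exact map_add (δ.1 m).1.1 u v
  map_smul' r u := by ext m; exact map_smul (δ.1 m).1.1 r u

/-- The anchor `α(δ)`, a vector field. -/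
def anchor (δ : GammaD EM F E) : VecField EM M := ⟨fun m => (δ.1 m).symbol, δ.2.2⟩

theorem ext {δ δ' : GammaD EM F E} (h : ∀ u, δ.op u = δ'.op u) (h' : δ.anchor = δ'.anchor) :
    δ = δ' :=
  Subtype.ext (funext fun m => DFib.ext (fun u => DFunLike.congr_fun (h u) m)
    (DFunLike.congr_fun h' m))

theorem op_smul (δ : GammaD EM F E) (f : SmoothFun EM M) (u : Sec EM F E) :
    δ.op (f • u) = f • δ.op u + δ.anchor.app f • u := by
  ext m
  exact (δ.1 m).leibniz f u

/-- The commutator bracket on `Γ(𝔇E)`. -/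
def bracket [T2Space M] (δ δ' : GammaD EM F E) : GammaD EM F E :=
  ⟨fun m => ⟨((δ.1 m).1.1 ∘ₗ δ'.op - (δ'.1 m).1.1 ∘ₗ δ.op, (δ.anchor.bracket δ'.anchor) m),
    fun f u => by
      have h : (δ.op (δ'.op (f • u)) - δ'.op (δ.op (f • u))) =
          f • (δ.op (δ'.op u) - δ'.op (δ.op u)) + (δ.anchor.bracket δ'.anchor).app f • u := by
        rw [VecField.bracket_app]
        simp only [op_smul, map_add]
        module
      exact DFunLike.congr_fun h m⟩,
    fun u => (δ.op (δ'.op u) - δ'.op (δ.op u)).contMDiff,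
    (δ.anchor.bracket δ'.anchor).contMDiff⟩

end GammaD

section LocalStructure

variable [T2Space M] [FiniteDimensional ℝ F] [ContMDiffVectorBundle ∞ F E 𝓘(ℝ, EM)]

/-- Derivations are local. -/
theorem DFib.app_congr {m : M} (d : DFib EM F E m) {u v : Sec EM F E}
    (h : ∀ᶠ p in 𝓝 m, u p = v p) : d.app u = d.app v := by
  obtain ⟨χ, hχ, hχ1⟩ := exists_bump (EM := EM) h
  have h1 : χ m = 1 := hχ1.self_of_nhds
  have h2 : χ • u = χ • v := by
    ext p
    by_cases hp : u p = v p
    · simp [Sec.smul_apply, hp]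
    · have : χ p = 0 := by
        by_contra h0
        exact hp (hχ (subset_tsupport _ h0))
      simp [Sec.smul_apply, this]
  have h3 := d.leibniz χ u
  rw [h2, d.leibniz χ v, h1, h.self_of_nhds] at h3
  simpa using h3.symm

theorem DFib.app_sum {ι : Type*} {m : M} (d : DFib EM F E m) (t : Finset ι)
    (s : ι → Sec EM F E) : d.app (∑ i ∈ t, s i) = ∑ i ∈ t, d.app (s i) :=
  map_sum d.1.1 s t

theorem DFib.sum_app {ι : Type*} {m : M} (t : Finset ι) (d : ι → DFib EM F E m)
    (u : Sec EM F E) : (∑ i ∈ t, d i).app u = ∑ i ∈ t, (d i).app u := by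
  classical
  induction t using Finset.induction_on with
  | empty => rfl
  | insert a t ha ih => rw [Finset.sum_insert ha, Finset.sum_insert ha, ← ih]; rfl

theorem DFib.sum_symbol {ι : Type*} {m : M} (t : Finset ι) (d : ι → DFib EM F E m) :
    (∑ i ∈ t, d i).symbol = ∑ i ∈ t, (d i).symbol := by
  classical
  induction t using Finset.induction_on with
  | empty => rfl
  | insert a t ha ih => rw [Finset.sum_insert ha, Finset.sum_insert ha, ← ih]; rfl

/-- Values of a derivation in terms of a frame. -/
theorem DFib.app_frame {k : ℕ} {s : Fin k → Sec EM F E} {c : Fin k → ∀ p : M, E p →ₗ[ℝ] ℝ}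
    (hc : ∀ i (u : Sec EM F E), ContMDiff 𝓘(ℝ, EM) 𝓘(ℝ, ℝ) ∞ (fun p => c i p (u p)))
    {m : M} (h : ∀ᶠ p in 𝓝 m, ∀ v : E p, v = ∑ i, c i p v • s i p)
    (d : DFib EM F E m) (u : Sec EM F E) :
    d.app u = ∑ i, (c i m (u m) • d.app (s i) +
      tder (⟨fun p => c i p (u p), hc i u⟩ : SmoothFun EM M) m d.symbol • s i m) := by
  let g : Fin k → SmoothFun EM M := fun i => ⟨fun p => c i p (u p), hc i u⟩
  have h1 : ∀ᶠ p in 𝓝 m, u p = (∑ i, g i • s i : Sec EM F E) p := by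
    filter_upwards [h] with p hp
    rw [Sec.sum_apply]
    exact hp (u p)
  rw [d.app_congr h1, d.app_sum]
  exact Finset.sum_congr rfl fun i _ => d.leibniz (g i) (s i)

/-- A derivation with vanishing symbol is an endomorphism of the fibre. -/
theorem DFib.exists_gl {m : M} (d : DFib EM F E m) (hd : d.symbol = 0) :
    ∃ Φ : E m →ₗ[ℝ] E m, d = glIncl m Φ := by
  obtain ⟨k, s, c, hc, h⟩ := exists_frame EM F E m
  refine ⟨∑ i, (c i m).smulRight (d.app (s i)), DFib.ext (fun u => ?_) hd⟩
  rw [DFib.app_frame hc h d u, hd]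
  change _ = (∑ i, (c i m).smulRight (d.app (s i))) (u m)
  simp

variable (EM F E) in
/-- Locally, the bundle `𝔇E` is generated by finitely many smooth sections, with coefficients
depending linearly and smoothly on the derivation. -/
theorem exists_gen (m : M) : ∃ (ι : Type) (_ : Fintype ι) (g : ι → GammaD EM F E)
    (b : ι → ∀ p : M, DFib EM F E p →ₗ[ℝ] ℝ),
    (∀ i (δ : GammaD EM F E), ContMDiff 𝓘(ℝ, EM) 𝓘(ℝ, ℝ) ∞ (fun p => b i p (δ.1 p))) ∧
    ∀ᶠ p in 𝓝 m, ∀ d : DFib EM F E p, d = ∑ i, b i p d • (g i).1 p := by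
  obtain ⟨k, s, c, hc, h⟩ := exists_frame EM F E m
  obtain ⟨n, X, a, ha, h'⟩ := exists_frame EM EM (TangentSpace 𝓘(ℝ, EM) : M → Type _) m
  obtain ⟨θ, hθ, hθ1⟩ := exists_bump (EM := EM) (h.and h')
  let C : Fin k → Sec EM F E → SmoothFun EM M := fun i u => ⟨fun p => c i p (u p), hc i u⟩
  have hCadd (i u v) : C i (u + v) = C i u + C i v := by
    ext p; exact map_add (c i p) (u p) (v p)
  have hCr (i) (r : ℝ) (u) : C i (r • u) = r • C i u := by
    ext p; exact map_smul (c i p) r (u p)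
  have hCsmul (i) (f : SmoothFun EM M) (u) : C i (f • u) = f * C i u := by
    ext p; exact map_smul (c i p) (f p) (u p)
  let D : Fin n → GammaD EM F E := fun i =>
    ⟨fun p => ⟨({ toFun := fun u => θ p • ∑ j, tder (C j u) p (X i p) • s j p
                  map_add' := fun u v => by
                    simp only [hCadd, tder_add, add_smul, Finset.sum_add_distrib, smul_add]
                  map_smul' := fun r u => by
                    simp only [hCr, tder_smul, mul_smul, ← Finset.smul_sum, RingHom.id_apply]
                    rw [smul_comm] }, θ p • X i p), fun f u => by
      have hp : θ p • u p = θ p • ∑ j, c j p (u p) • s j p := by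
        by_cases h0 : θ p = 0
        · simp [h0]
        · rw [← (hθ (subset_tsupport _ h0)).1 (u p)]
      have hs : ∑ j, tder (C j (f • u)) p (X i p) • s j p =
          f p • ∑ j, tder (C j u) p (X i p) • s j p +
            tder f p (X i p) • ∑ j, c j p (u p) • s j p := by
        rw [Finset.smul_sum, Finset.smul_sum, ← Finset.sum_add_distrib]
        refine Finset.sum_congr rfl fun j _ => ?_
        have hCj : C j u p = c j p (u p) := rfl
        rw [hCsmul, tder_mul, hCj]
        module
      simp only [LinearMap.coe_mk, AddHom.coe_mk, map_smul, smul_eq_mul]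
      rw [hs, smul_add, smul_comm (θ p) (tder f p (X i p)), ← hp]
      module⟩,
     fun u => ((θ • ∑ j, VecField.app (X i) (C j u) • s j : Sec EM F E)).contMDiff.congr
      (fun p => by rw [Sec.smul_apply, Sec.sum_apply]; rfl), (θ • X i).contMDiff⟩
  let G : Fin k × Fin k → GammaD EM F E := fun i =>
    ⟨fun p => glIncl p ((c i.1 p).smulRight (s i.2 p)),
     fun u => (C i.1 u • s i.2).contMDiff, (0 : VecField EM M).contMDiff⟩
  refine ⟨Fin n ⊕ (Fin k × Fin k), inferInstance, Sum.elim D G,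
    Sum.elim (fun i p => a i p ∘ₗ LinearMap.snd ℝ _ _ ∘ₗ Submodule.subtype _)
      (fun i p => c i.2 p ∘ₗ LinearMap.applyₗ (s i.1) ∘ₗ LinearMap.fst ℝ _ _ ∘ₗ
        Submodule.subtype _), ?_, ?_⟩
  · rintro (i | i) δ
    · exact ha i δ.anchor
    · exact hc i.2 (δ.op (s i.1))
  · filter_upwards [h.eventually_nhds, h', hθ1] with p hp hp' hp1 d
    have hp1 : θ p = 1 := hp1
    rw [Fintype.sum_sum_type]
    refine DFib.ext (fun u => ?_) ?_
    · have e1 (d1 d2 : DFib EM F E p) : (d1 + d2).app u = d1.app u + d2.app u := rfl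
      have e2 (r : ℝ) (d1 : DFib EM F E p) : (r • d1).app u = r • d1.app u := rfl
      rw [e1, DFib.sum_app, DFib.sum_app, DFib.app_frame hc hp d u, Finset.sum_add_distrib,
        add_comm]
      simp only [e2, Sum.elim_inl, Sum.elim_inr, Fintype.sum_prod_type]
      congr 1
      · have e3 (i : Fin n) : ((D i).1 p).app u = ∑ j, tder (C j u) p (X i p) • s j p := by
          change θ p • (∑ j, tder (C j u) p (X i p) • s j p) = _
          rw [hp1, one_smul]
        have e4 (i : Fin n) : (a i p ∘ₗ LinearMap.snd ℝ _ _ ∘ₗ Submodule.subtype _) d =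
            a i p d.symbol := rfl
        simp only [e3, e4, Finset.smul_sum]
        rw [Finset.sum_comm]
        refine Finset.sum_congr rfl fun j _ => ?_
        change tder (C j u) p d.symbol • _ = _
        conv_lhs => rw [hp' d.symbol, map_sum, Finset.sum_smul]
        exact Finset.sum_congr rfl fun i _ => by rw [map_smul, smul_assoc]
      · refine Finset.sum_congr rfl fun j _ => ?_
        conv_lhs => rw [hp.self_of_nhds (d.app (s j)), Finset.smul_sum]
        refine Finset.sum_congr rfl fun l _ => ?_
        exact smul_comm _ _ _
    · have e1 (d1 d2 : DFib EM F E p) : (d1 + d2).symbol = d1.symbol + d2.symbol := rfl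
      rw [e1, DFib.sum_symbol, DFib.sum_symbol, hp' d.symbol]
      have e2 (i : Fin k × Fin k) (r : ℝ) : (r • ((G i).1 p : DFib EM F E p)).symbol = 0 := smul_zero r
      have e3 (i : Fin n) (r : ℝ) : (r • ((D i).1 p : DFib EM F E p)).symbol = r • X i p := by
        change r • θ p • X i p = r • X i p
        rw [hp1, one_smul]
      simp only [Sum.elim_inl, Sum.elim_inr, e2, e3, Finset.sum_const_zero, add_zero]
      rfl

theorem GammaD.sum_val {ι : Type*} (t : Finset ι) (g : ι → GammaD EM F E) (p : M) :
    (∑ i ∈ t, g i).1 p = ∑ i ∈ t, (g i).1 p := by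
  classical
  induction t using Finset.induction_on with
  | empty => rfl
  | insert a t ha ih => rw [Finset.sum_insert ha, Finset.sum_insert ha, ← ih]; rfl

/-- Every element of a fibre of `𝔇E` is the value of a global smooth section. -/
theorem exists_gammaD {m : M} (d : DFib EM F E m) : ∃ δ : GammaD EM F E, δ.1 m = d := by
  obtain ⟨ι, _, g, b, -, h⟩ := exists_gen EM F E m
  refine ⟨∑ i, b i m d • g i, ?_⟩
  rw [GammaD.sum_val]
  exact (h.self_of_nhds d).symm

/-- Every endomorphism of a fibre of `E` extends to a global smooth endomorphism of `E`. -/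
theorem exists_gl_field {m : M} (Φ : E m →ₗ[ℝ] E m) :
    ∃ (Ψ : ∀ p : M, E p →ₗ[ℝ] E p) (γ : GammaD EM F E),
      (∀ p, γ.1 p = glIncl p (Ψ p)) ∧ Ψ m = Φ := by
  obtain ⟨k, s, c, hc, h⟩ := exists_frame EM F E m
  let C : Fin k → Sec EM F E → SmoothFun EM M := fun i u => ⟨fun p => c i p (u p), hc i u⟩
  refine ⟨fun p => ∑ i, ∑ j, c j m (Φ (s i m)) • (c i p).smulRight (s j p),
    ⟨fun p => glIncl p (∑ i, ∑ j, c j m (Φ (s i m)) • (c i p).smulRight (s j p)),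
      fun u => (∑ i, ∑ j, c j m (Φ (s i m)) • C i u • s j : Sec EM F E).contMDiff.congr
        fun p => ?_, (0 : VecField EM M).contMDiff⟩, fun p => rfl, ?_⟩
  · congr 1
    simp only [Sec.sum_apply]
    change (∑ i, ∑ j, c j m (Φ (s i m)) • (c i p).smulRight (s j p)) (u p) = _
    simp only [LinearMap.sum_apply]
    rfl
  · ext v
    conv_rhs => rw [h.self_of_nhds v, map_sum]
    simp only [LinearMap.sum_apply]
    refine Finset.sum_congr rfl fun i _ => ?_
    rw [map_smul, h.self_of_nhds (Φ (s i m)), Finset.smul_sum, ← h.self_of_nhds (Φ (s i m))]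
    exact Finset.sum_congr rfl fun j _ => smul_comm _ _ _

/-- A `C^∞(M)`-linear map from sections of `𝔇E` to sections of `E` is a bundle map. -/
theorem exists_bundle_map (T : GammaD EM F E →ₗ[SmoothFun EM M] Sec EM F E) (m : M) :
    ∃ τ : DFib EM F E m →ₗ[ℝ] E m, ∀ δ, τ (δ.1 m) = T δ m := by
  obtain ⟨ι, _, g, b, hb, h⟩ := exists_gen EM F E m
  refine ⟨∑ i, (b i m).smulRight (T (g i) m), fun δ => ?_⟩
  let B : ι → SmoothFun EM M := fun i => ⟨fun p => b i p (δ.1 p), hb i δ⟩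
  obtain ⟨χ, hχ, hχ1⟩ := exists_bump (EM := EM) h
  have h1 : χ m = 1 := hχ1.self_of_nhds
  have h2 : χ • δ = χ • ∑ i, B i • g i := by
    refine Subtype.ext (funext fun p => ?_)
    change χ p • δ.1 p = χ p • (∑ i, B i • g i : GammaD EM F E).1 p
    by_cases h0 : χ p = 0
    · simp [h0]
    · have hp := hχ (subset_tsupport _ h0)
      rw [GammaD.sum_val]
      congr 1
      exact hp (δ.1 p)
  have h3 := DFunLike.congr_fun (congrArg T h2) m
  rw [map_smul, map_smul, map_sum, Sec.smul_apply, Sec.smul_apply, h1, one_smul, one_smul,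
    Sec.sum_apply] at h3
  rw [h3, LinearMap.sum_apply]
  refine Finset.sum_congr rfl fun i _ => ?_
  rw [map_smul]
  rfl

end LocalStructure

/-! ### The jet bundle -/

variable (EM F E) in
/-- The fibre at `m` of the first jet bundle `𝔍E`, realised by means of the `E`-pairing with
`𝔇E`: the linear maps `ν : (𝔇E)_m → E_m` with `ν(Φ) = Φ(ν(1))` for all `Φ ∈ gl(E_m)`. The jet
`[u]_m` of a section `u` is the map `d ↦ d u`. -/
def jetSubmodule (m : M) : Submodule ℝ (DFib EM F E m →ₗ[ℝ] E m) where
  carrier := {ν | ∀ Φ : E m →ₗ[ℝ] E m,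
    ν (glIncl m Φ) = Φ (ν (glIncl m LinearMap.id))}
  zero_mem' Φ := by simp
  add_mem' {ν ν'} h h' Φ := by simp only [LinearMap.add_apply, h Φ, h' Φ, map_add]
  smul_mem' r ν h Φ := by simp only [LinearMap.smul_apply, h Φ, map_smul]

variable (EM F E) in
/-- The fibre `(𝔍E)_m`, as a type. -/
abbrev JFib (m : M) : Type _ := jetSubmodule EM F E m

instance (m : M) : AddCommGroup (JFib EM F E m) := inferInstance

instance (m : M) : Module ℝ (JFib EM F E m) := inferInstance

/-- The jet `[u]_m` of a section `u` of `E`. -/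
def jet (m : M) (u : Sec EM F E) : JFib EM F E m :=
  ⟨{ toFun := fun d => d.app u
     map_add' := fun _ _ => rfl
     map_smul' := fun _ _ => rfl }, fun _ => rfl⟩

variable (EM F E) in
/-- `Γ(𝔍E)`: a section of `𝔍E` is smooth iff its pairing with every smooth section of `𝔇E` is a
smooth section of `E`. -/
def gammaJSubmodule : Submodule (SmoothFun EM M) (AllSec EM fun m : M => JFib EM F E m) where
  carrier := {μ | ∀ δ : GammaD EM F E, ContMDiff 𝓘(ℝ, EM) (𝓘(ℝ, EM).prod 𝓘(ℝ, F)) ∞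
      fun m => TotalSpace.mk' F m ((μ m).1 (δ.1 m))}
  zero_mem' _ := (0 : Sec EM F E).contMDiff
  add_mem' h h' δ := (h δ).add_section (h' δ)
  smul_mem' f _ h δ := f.contMDiff.smul_section (h δ)

variable (EM F E) in
/-- The space `Γ(𝔍E)`, as a type. -/
abbrev GammaJ : Type _ := gammaJSubmodule EM F E

instance : AddCommGroup (GammaJ EM F E) := inferInstance

instance : Module (SmoothFun EM M) (GammaJ EM F E) := inferInstance

namespace GammaJ

/-- The `E`-valued pairing `⟨μ, δ⟩_E` of sections of `𝔍E` and `𝔇E`. -/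
def pair (μ : GammaJ EM F E) (δ : GammaD EM F E) : Sec EM F E :=
  ⟨fun m => (μ.1 m).1 (δ.1 m), μ.2 δ⟩

theorem pair_add (μ : GammaJ EM F E) (δ δ' : GammaD EM F E) :
    μ.pair (δ + δ') = μ.pair δ + μ.pair δ' := by
  ext m; exact map_add (μ.1 m).1 _ _

theorem pair_sub (μ : GammaJ EM F E) (δ δ' : GammaD EM F E) :
    μ.pair (δ - δ') = μ.pair δ - μ.pair δ' := by
  ext m; exact map_sub (μ.1 m).1 _ _

theorem pair_smul (μ : GammaJ EM F E) (f : SmoothFun EM M) (δ : GammaD EM F E) :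
    μ.pair (f • δ) = f • μ.pair δ := by
  ext m; exact map_smul (μ.1 m).1 (f m) _

theorem add_pair (μ μ' : GammaJ EM F E) (δ : GammaD EM F E) :
    (μ + μ').pair δ = μ.pair δ + μ'.pair δ := rfl

theorem sub_pair (μ μ' : GammaJ EM F E) (δ : GammaD EM F E) :
    (μ - μ').pair δ = μ.pair δ - μ'.pair δ := rfl

theorem smul_pair (f : SmoothFun EM M) (μ : GammaJ EM F E) (δ : GammaD EM F E) :
    (f • μ).pair δ = f • μ.pair δ := rfl

end GammaJ

/-- The section `𝕕u : m ↦ [u]_m` of `𝔍E`. -/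
def jetSec (u : Sec EM F E) : GammaJ EM F E := ⟨fun m => jet m u, fun δ => (δ.op u).contMDiff⟩

theorem jetSec_pair (u : Sec EM F E) (δ : GammaD EM F E) : (jetSec u).pair δ = δ.op u := rfl

namespace GammaD

theorem op_add (δ δ' : GammaD EM F E) (u : Sec EM F E) :
    (δ + δ').op u = δ.op u + δ'.op u := rfl

theorem smul_op (f : SmoothFun EM M) (δ : GammaD EM F E) (u : Sec EM F E) :
    (f • δ).op u = f • δ.op u := rfl

variable [T2Space M]

theorem bracket_op (δ δ' : GammaD EM F E) (u : Sec EM F E) :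
    (δ.bracket δ').op u = δ.op (δ'.op u) - δ'.op (δ.op u) := rfl

theorem bracket_anchor (δ δ' : GammaD EM F E) :
    (δ.bracket δ').anchor = δ.anchor.bracket δ'.anchor := rfl

theorem bracket_self (δ : GammaD EM F E) : δ.bracket δ = 0 :=
  ext (fun u => sub_self (δ.op (δ.op u))) (VecField.bracket_self δ.anchor)

theorem bracket_swap (δ δ' : GammaD EM F E) : δ.bracket δ' = - δ'.bracket δ :=
  ext (fun u => (neg_sub (δ'.op (δ.op u)) (δ.op (δ'.op u))).symm)
    (VecField.bracket_swap δ.anchor δ'.anchor)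

theorem bracket_add (δ δ₁ δ₂ : GammaD EM F E) :
    δ.bracket (δ₁ + δ₂) = δ.bracket δ₁ + δ.bracket δ₂ := by
  refine ext (fun u => ?_) (VecField.bracket_add δ.anchor δ₁.anchor δ₂.anchor)
  simp only [bracket_op, op_add, map_add]
  abel

theorem bracket_smul (δ : GammaD EM F E) (f : SmoothFun EM M) (δ' : GammaD EM F E) :
    δ.bracket (f • δ') = f • δ.bracket δ' + VecField.app δ.anchor f • δ' := by
  refine ext (fun u => ?_) ?_
  · simp only [bracket_op, op_add, smul_op, op_smul, smul_sub]
    abel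
  · exact (VecField.bracket_smul δ.anchor f δ'.anchor).trans (add_comm _ _)

theorem add_bracket (δ₁ δ₂ δ : GammaD EM F E) :
    (δ₁ + δ₂).bracket δ = δ₁.bracket δ + δ₂.bracket δ := by
  rw [bracket_swap, bracket_add, neg_add, ← bracket_swap, ← bracket_swap]

theorem smul_bracket (f : SmoothFun EM M) (δ δ' : GammaD EM F E) :
    bracket (f • δ) δ' = f • δ.bracket δ' - VecField.app δ'.anchor f • δ := by
  rw [bracket_swap, bracket_smul, bracket_swap δ' δ]
  module

end GammaD

section LieDerivative

variable [T2Space M] [FiniteDimensional ℝ F] [ContMDiffVectorBundle ∞ F E 𝓘(ℝ, EM)]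

/-- A section of `𝔍E` is determined by its pairings with the sections of `𝔇E`. -/
theorem GammaJ.ext {μ μ' : GammaJ EM F E} (h : ∀ δ, μ.pair δ = μ'.pair δ) : μ = μ' := by
  refine Subtype.ext (funext fun m => Subtype.ext (LinearMap.ext fun d => ?_))
  obtain ⟨δ, rfl⟩ := exists_gammaD d
  exact DFunLike.congr_fun (h δ) m

/-- The section `1_E` of `𝔇E`. -/
def GammaD.one : GammaD EM F E :=
  ⟨fun p => glIncl p LinearMap.id, fun u => u.contMDiff, (0 : VecField EM M).contMDiff⟩

theorem GammaJ.pair_of_anchor (μ : GammaJ EM F E) (γ : GammaD EM F E) (h : γ.anchor = 0) :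
    μ.pair γ = γ.op (μ.pair GammaD.one) := by
  ext m
  obtain ⟨Φ, hΦ⟩ := DFib.exists_gl (γ.1 m) (DFunLike.congr_fun h m)
  change (μ.1 m).1 (γ.1 m) = (γ.1 m).app (μ.pair GammaD.one)
  rw [hΦ, (μ.1 m).2 Φ]
  rfl

/-- The `C^∞(M)`-linear map `δ' ↦ δ⟨μ, δ'⟩ - ⟨μ, [δ, δ']⟩`. -/
def lieDerivMap (δ : GammaD EM F E) (μ : GammaJ EM F E) :
    GammaD EM F E →ₗ[SmoothFun EM M] Sec EM F E where
  toFun δ' := δ.op (μ.pair δ') - μ.pair (δ.bracket δ')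
  map_add' δ₁ δ₂ := by
    simp only [GammaJ.pair_add, GammaD.bracket_add, map_add]
    abel
  map_smul' f δ' := by
    simp only [GammaJ.pair_smul, GammaJ.pair_add, GammaD.bracket_smul, GammaD.op_smul,
      RingHom.id_apply, smul_sub]
    abel

/-- The Lie derivative of a section of `𝔍E` along a section of `𝔇E` exists. -/
theorem exists_lieDeriv (δ : GammaD EM F E) (μ : GammaJ EM F E) :
    ∃ μ' : GammaJ EM F E, ∀ δ', μ'.pair δ' = δ.op (μ.pair δ') - μ.pair (δ.bracket δ') := by
  choose τ hτ using exists_bundle_map (lieDerivMap δ μ)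
  have hone (m : M) : τ m (glIncl m LinearMap.id) = δ.op (μ.pair GammaD.one) m := by
    have h := hτ m GammaD.one
    have h2 : lieDerivMap δ μ GammaD.one = δ.op (μ.pair GammaD.one) := by
      change δ.op (μ.pair GammaD.one) - μ.pair (δ.bracket GammaD.one) = _
      rw [GammaJ.pair_of_anchor μ (δ.bracket GammaD.one) (VecField.bracket_zero δ.anchor)]
      exact (congrArg _ (sub_self (δ.op (μ.pair GammaD.one)))).trans (sub_zero _)
    rw [h2] at h
    exact h
  refine ⟨⟨fun m => ⟨τ m, fun Φ => ?_⟩, fun δ' => ?_⟩, fun δ' => ?_⟩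
  · obtain ⟨Ψ, γ, hγ, rfl⟩ := exists_gl_field (EM := EM) (F := F) Φ
    have ha : γ.anchor = 0 := by
      ext p
      exact congrArg DFib.symbol (hγ p)
    have h := hτ m γ
    have h2 : lieDerivMap δ μ γ = γ.op (δ.op (μ.pair GammaD.one)) := by
      have ha' : (δ.bracket γ).anchor = 0 := by
        rw [GammaD.bracket_anchor, ha]
        exact VecField.bracket_zero δ.anchor
      change δ.op (μ.pair γ) - μ.pair (δ.bracket γ) = _
      rw [GammaJ.pair_of_anchor μ γ ha, GammaJ.pair_of_anchor μ _ ha', GammaD.bracket_op,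
        sub_sub_cancel]
    rw [h2, hγ m] at h
    rw [hone m, h]
    exact congrArg (fun d => DFib.app d (δ.op (μ.pair GammaD.one))) (hγ m)
  · refine (lieDerivMap δ μ δ').contMDiff.congr fun m => ?_
    exact congrArg (TotalSpace.mk' F m) (hτ m δ')
  · ext m
    exact hτ m δ'

/-- The Lie derivative `𝔏_δ μ` of a section of `𝔍E` along a section of `𝔇E`, determined by
`⟨𝔏_δ μ, δ'⟩ = δ⟨μ, δ'⟩ - ⟨μ, [δ, δ']⟩` for all sections `δ'` of `𝔇E`. -/
def lieDeriv (δ : GammaD EM F E) (μ : GammaJ EM F E) : GammaJ EM F E :=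
  (exists_lieDeriv δ μ).choose

theorem lieDeriv_pair (δ : GammaD EM F E) (μ : GammaJ EM F E) (δ' : GammaD EM F E) :
    (lieDeriv δ μ).pair δ' = δ.op (μ.pair δ') - μ.pair (δ.bracket δ') :=
  (exists_lieDeriv δ μ).choose_spec δ'

end LieDerivative

/-! ### The omni-Lie algebroid `𝓔 = 𝔇E ⊕ 𝔍E` -/

variable (EM F E) in
/-- The fibre of `𝓔 = 𝔇E ⊕ 𝔍E` at `m`. -/
abbrev OmniFib (m : M) : Type _ := DFib EM F E m × JFib EM F E m

variable (EM F E) in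
/-- `Γ(𝓔) = Γ(𝔇E) ⊕ Γ(𝔍E)`. -/
abbrev GammaOmni : Type _ := GammaD EM F E × GammaJ EM F E

/-- The value at `m` of a section of `𝓔`. -/
def GammaOmni.val (X : GammaOmni EM F E) (m : M) : OmniFib EM F E m := (X.1.1 m, X.2.1 m)

/-- The symmetric `E`-valued pairing
`⟨d + μ, r + ν⟩_E = (⟨d, ν⟩_E + ⟨r, μ⟩_E) / 2` on the fibre `𝓔_m`. -/
def omniPair {m : M} (v w : OmniFib EM F E m) : E m :=
  (1 / 2 : ℝ) • (w.2.1 v.1 + v.2.1 w.1)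

/-- The pairing of two sections of `𝓔`, a section of `E`. -/
def omniPairSec (X Y : GammaOmni EM F E) : Sec EM F E :=
  ⟨fun m => omniPair (X.val m) (Y.val m), ((1 / 2 : ℝ) • (Y.2.pair X.1 + X.2.pair Y.1)).contMDiff⟩

/-- A smooth vector subbundle of `𝓔`: a family of subspaces of the fibres which near every point
is spanned by finitely many pointwise linearly independent smooth sections. -/
def IsSubbundle (L : ∀ m : M, Submodule ℝ (OmniFib EM F E m)) : Prop :=
  ∀ m : M, ∃ (k : ℕ) (s : Fin k → GammaOmni EM F E), ∀ᶠ p in 𝓝 m,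
    LinearIndependent ℝ (fun i => (s i).val p) ∧
      Submodule.span ℝ (Set.range fun i => (s i).val p) = L p

/-- A subspace of a fibre of `𝓔` is isotropic if the pairing vanishes on it. -/
def IsIsotropic {m : M} (W : Submodule ℝ (OmniFib EM F E m)) : Prop :=
  ∀ v ∈ W, ∀ w ∈ W, omniPair v w = 0

/-- The `C^∞(M)`-module `Γ(L)` of sections of `𝓔` with values in `L`. -/
def GammaSub (L : ∀ m : M, Submodule ℝ (OmniFib EM F E m)) :
    Submodule (SmoothFun EM M) (GammaOmni EM F E) where
  carrier := {X | ∀ m, X.val m ∈ L m}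
  zero_mem' m := (L m).zero_mem
  add_mem' h h' m := (L m).add_mem (h m) (h' m)
  smul_mem' f _ h m := (L m).smul_mem (f m) (h m)

instance (L : ∀ m : M, Submodule ℝ (OmniFib EM F E m)) : AddCommGroup (GammaSub L) :=
  inferInstance

instance (L : ∀ m : M, Submodule ℝ (OmniFib EM F E m)) :
    Module (SmoothFun EM M) (GammaSub L) := inferInstance

section Dorfman

variable [T2Space M] [FiniteDimensional ℝ F] [ContMDiffVectorBundle ∞ F E 𝓘(ℝ, EM)]

/-- The bracket
`{d + μ, r + ν} = [d, r] + 𝔏_d ν - 𝔏_r μ + 𝕕⟨μ, r⟩_E` on `Γ(𝓔)`. -/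
def dorfman (X Y : GammaOmni EM F E) : GammaOmni EM F E :=
  (X.1.bracket Y.1, lieDeriv X.1 Y.2 - lieDeriv Y.1 X.2 + jetSec (X.2.pair Y.1))

/-- A Dirac structure in `𝓔`: a maximal isotropic subbundle whose sections are closed under the
bracket. -/
structure IsDirac (L : ∀ m : M, Submodule ℝ (OmniFib EM F E m)) : Prop where
  subbundle : IsSubbundle L
  maximal : ∀ m, Maximal IsIsotropic (L m)
  closed : ∀ X ∈ GammaSub L, ∀ Y ∈ GammaSub L, dorfman X Y ∈ GammaSub L

/-- The normalizer `N_L` of `L` in `Γ(𝓔)`. -/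
def normalizer (L : ∀ m : M, Submodule ℝ (OmniFib EM F E m)) : Set (GammaOmni EM F E) :=
  {X | ∀ Y ∈ GammaSub L, dorfman X Y ∈ GammaSub L}

theorem GammaOmni.ext {X Y : GammaOmni EM F E} (h : X.1 = Y.1)
    (h' : ∀ δ, X.2.pair δ = Y.2.pair δ) : X = Y :=
  Prod.ext h (GammaJ.ext h')

theorem dorfman_pair (X Y : GammaOmni EM F E) (δ : GammaD EM F E) :
    (dorfman X Y).2.pair δ = X.1.op (Y.2.pair δ) - Y.2.pair (X.1.bracket δ) -
      (Y.1.op (X.2.pair δ) - X.2.pair (Y.1.bracket δ)) + δ.op (X.2.pair Y.1) := by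
  simp only [dorfman, GammaJ.add_pair, GammaJ.sub_pair, lieDeriv_pair, jetSec_pair]

theorem dorfman_add (X Y Z : GammaOmni EM F E) :
    dorfman X (Y + Z) = dorfman X Y + dorfman X Z := by
  refine GammaOmni.ext (GammaD.bracket_add _ _ _) fun δ => ?_
  change _ = (dorfman X Y).2.pair δ + (dorfman X Z).2.pair δ
  simp only [dorfman_pair, Prod.fst_add, Prod.snd_add, GammaJ.pair_add, GammaJ.add_pair,
    GammaD.op_add, GammaD.add_bracket, map_add]
  abel

theorem add_dorfman (X Y Z : GammaOmni EM F E) :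
    dorfman (X + Y) Z = dorfman X Z + dorfman Y Z := by
  refine GammaOmni.ext (GammaD.add_bracket _ _ _) fun δ => ?_
  change _ = (dorfman X Z).2.pair δ + (dorfman Y Z).2.pair δ
  simp only [dorfman_pair, Prod.fst_add, Prod.snd_add, GammaJ.pair_add, GammaJ.add_pair,
    GammaD.op_add, GammaD.add_bracket, map_add]
  abel

theorem dorfman_smul (X : GammaOmni EM F E) (f : SmoothFun EM M) (Y : GammaOmni EM F E) :
    dorfman X (f • Y) = f • dorfman X Y + VecField.app X.1.anchor f • Y := by
  refine GammaOmni.ext (GammaD.bracket_smul _ _ _) fun δ => ?_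
  change _ = f • (dorfman X Y).2.pair δ + VecField.app X.1.anchor f • Y.2.pair δ
  have h : X.2.pair (GammaD.bracket (f • Y.1) δ) =
      f • X.2.pair (Y.1.bracket δ) - VecField.app δ.anchor f • X.2.pair Y.1 := by
    rw [GammaD.smul_bracket, GammaJ.pair_sub, GammaJ.pair_smul, GammaJ.pair_smul]
  simp only [dorfman_pair, Prod.smul_fst, Prod.smul_snd, GammaJ.pair_smul, GammaJ.smul_pair,
    GammaD.smul_op, GammaD.op_smul, h]
  module

theorem dorfman_self (X : GammaOmni EM F E) : dorfman X X = (0, jetSec (omniPairSec X X)) := by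
  refine GammaOmni.ext (GammaD.bracket_self _) fun δ => ?_
  have h : omniPairSec X X = X.2.pair X.1 := by
    ext m
    change (1 / 2 : ℝ) • (X.2.pair X.1 m + X.2.pair X.1 m) = X.2.pair X.1 m
    module
  rw [h, dorfman_pair, sub_self, zero_add]
  rfl

end Dorfman

/-! ### The cochain complex of a Dirac structure in degrees one and two -/

/-- `Ω¹(L, E) = Γ(Hom(L, E))`. -/
abbrev OneCochain (L : ∀ m : M, Submodule ℝ (OmniFib EM F E m)) : Type _ :=
  GammaSub L →ₗ[SmoothFun EM M] Sec EM F E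

/-- `Ω²(L, E) = Γ(Hom(∧²L, E))`: alternating `C^∞(M)`-bilinear maps `Γ(L) × Γ(L) → Γ(E)`. -/
def TwoCochain (L : ∀ m : M, Submodule ℝ (OmniFib EM F E m)) :
    Submodule (SmoothFun EM M)
      (GammaSub L →ₗ[SmoothFun EM M] GammaSub L →ₗ[SmoothFun EM M] Sec EM F E) where
  carrier := {β | ∀ l, β l l = 0}
  zero_mem' _ := rfl
  add_mem' h h' l := by simp [h l, h' l]
  smul_mem' f _ h l := by simp [h l]

theorem omniPairSec_add (X Y Z : GammaOmni EM F E) :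
    omniPairSec X (Y + Z) = omniPairSec X Y + omniPairSec X Z := by
  ext m
  change (1 / 2 : ℝ) • ((Y.2.pair X.1 m + Z.2.pair X.1 m) + X.2.pair (Y.1 + Z.1) m) =
    (1 / 2 : ℝ) • (Y.2.pair X.1 m + X.2.pair Y.1 m) +
      (1 / 2 : ℝ) • (Z.2.pair X.1 m + X.2.pair Z.1 m)
  rw [GammaJ.pair_add]
  change (1 / 2 : ℝ) • ((Y.2.pair X.1 m + Z.2.pair X.1 m) + (X.2.pair Y.1 m + X.2.pair Z.1 m)) = _
  module

theorem omniPairSec_smul (X : GammaOmni EM F E) (f : SmoothFun EM M) (Y : GammaOmni EM F E) :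
    omniPairSec X (f • Y) = f • omniPairSec X Y := by
  ext m
  change (1 / 2 : ℝ) • (f m • Y.2.pair X.1 m + X.2.pair (f • Y.1) m) =
    f m • (1 / 2 : ℝ) • (Y.2.pair X.1 m + X.2.pair Y.1 m)
  rw [GammaJ.pair_smul, Sec.smul_apply]
  module

/-- The `1`-cochain `ω_X = ⟨X, ·⟩_E` on `L`. -/
def omega (L : ∀ m : M, Submodule ℝ (OmniFib EM F E m)) (X : GammaOmni EM F E) : OneCochain L where
  toFun l := omniPairSec X l.1
  map_add' l l' := omniPairSec_add X l.1 l'.1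
  map_smul' f l := omniPairSec_smul X f l.1

section Differential

variable [T2Space M] [FiniteDimensional ℝ F] [ContMDiffVectorBundle ∞ F E 𝓘(ℝ, EM)]

variable {L : ∀ m : M, Submodule ℝ (OmniFib EM F E m)}

/-- The bracket of the Lie algebroid `L`. -/
def IsDirac.bracket (hL : IsDirac L) (l l' : GammaSub L) : GammaSub L :=
  ⟨dorfman l.1 l'.1, hL.closed l.1 l.2 l'.1 l'.2⟩

/-- The representation `ρ_L : L → 𝔇E`, the projection to the first component. -/
def rep (l : GammaSub L) : GammaD EM F E := l.1.1

theorem IsDirac.bracket_add (hL : IsDirac L) (l l₁ l₂ : GammaSub L) :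
    hL.bracket l (l₁ + l₂) = hL.bracket l l₁ + hL.bracket l l₂ :=
  Subtype.ext (dorfman_add l.1 l₁.1 l₂.1)

theorem IsDirac.add_bracket (hL : IsDirac L) (l₁ l₂ l : GammaSub L) :
    hL.bracket (l₁ + l₂) l = hL.bracket l₁ l + hL.bracket l₂ l :=
  Subtype.ext (add_dorfman l₁.1 l₂.1 l.1)

theorem IsDirac.bracket_smul (hL : IsDirac L) (l : GammaSub L) (f : SmoothFun EM M)
    (l' : GammaSub L) :
    hL.bracket l (f • l') = f • hL.bracket l l' + VecField.app (rep l).anchor f • l' :=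
  Subtype.ext (dorfman_smul l.1 f l'.1)

theorem IsDirac.bracket_self (hL : IsDirac L) (l : GammaSub L) : hL.bracket l l = 0 := by
  refine Subtype.ext ((dorfman_self l.1).trans ?_)
  have h : omniPairSec l.1 l.1 = 0 := by
    ext m
    exact (hL.maximal m).prop _ (l.2 m) _ (l.2 m)
  rw [h]
  exact GammaOmni.ext rfl fun δ => map_zero δ.op

/-- The value of the coboundary of a `1`-cochain `η` on `l, l'`:
`ρ_L(l) η(l') - ρ_L(l') η(l) - η({l, l'})`. -/
def IsDirac.coboundaryFun (hL : IsDirac L) (η : OneCochain L) (l l' : GammaSub L) : Sec EM F E :=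
  (rep l).op (η l') - (rep l').op (η l) - η (hL.bracket l l')

theorem IsDirac.coboundaryFun_self (hL : IsDirac L) (η : OneCochain L) (l : GammaSub L) :
    hL.coboundaryFun η l l = 0 := by
  simp [coboundaryFun, hL.bracket_self]

theorem IsDirac.coboundaryFun_add (hL : IsDirac L) (η : OneCochain L) (l l₁ l₂ : GammaSub L) :
    hL.coboundaryFun η l (l₁ + l₂) = hL.coboundaryFun η l l₁ + hL.coboundaryFun η l l₂ := by
  have h : rep (l₁ + l₂) = rep l₁ + rep l₂ := rfl
  simp only [coboundaryFun, hL.bracket_add, map_add, h, GammaD.op_add]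
  abel

theorem IsDirac.coboundaryFun_smul (hL : IsDirac L) (η : OneCochain L) (l : GammaSub L)
    (f : SmoothFun EM M) (l' : GammaSub L) :
    hL.coboundaryFun η l (f • l') = f • hL.coboundaryFun η l l' := by
  have h : rep (f • l') = f • rep l' := rfl
  simp only [coboundaryFun, hL.bracket_smul, map_add, map_smul, h, GammaD.smul_op, GammaD.op_smul]
  module

theorem IsDirac.coboundaryFun_swap (hL : IsDirac L) (η : OneCochain L) (l l' : GammaSub L) :
    hL.coboundaryFun η l l' = - hL.coboundaryFun η l' l := by
  have h1 : hL.bracket l l' + hL.bracket l' l = 0 := by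
    have := hL.bracket_self (l + l')
    rwa [hL.bracket_add, hL.add_bracket, hL.add_bracket, hL.bracket_self, hL.bracket_self,
      zero_add, add_zero, add_comm] at this
  have h2 := congrArg η h1
  rw [map_add, map_zero] at h2
  have h3 : hL.coboundaryFun η l l' + hL.coboundaryFun η l' l =
      - (η (hL.bracket l l') + η (hL.bracket l' l)) := by
    simp only [coboundaryFun]
    abel
  rw [h2, neg_zero] at h3
  exact eq_neg_of_add_eq_zero_left h3

/-- The coboundary operator `d_L : Ω¹(L, E) → Ω²(L, E)` of the Lie algebroid `L` with values in
the representation `ρ_L`. -/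
def IsDirac.dL (hL : IsDirac L) (η : OneCochain L) : TwoCochain L :=
  ⟨LinearMap.mk₂ (SmoothFun EM M) (hL.coboundaryFun η)
    (fun l₁ l₂ l => by
      rw [hL.coboundaryFun_swap, hL.coboundaryFun_add, neg_add, ← hL.coboundaryFun_swap,
        ← hL.coboundaryFun_swap])
    (fun f l l' => by
      rw [hL.coboundaryFun_swap, hL.coboundaryFun_smul, ← smul_neg, ← hL.coboundaryFun_swap])
    (hL.coboundaryFun_add η) (fun f l l' => hL.coboundaryFun_smul η l f l'),
    hL.coboundaryFun_self η⟩

end Differential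

end OmniLie

end

open OmniLie

noncomputable section

namespace OmniLie

variable {EM : Type*} [NormedAddCommGroup EM] [NormedSpace ℝ EM]
  {M : Type*} [TopologicalSpace M] [ChartedSpace EM M] [IsManifold 𝓘(ℝ, EM) ∞ M]
  {F : Type*} [NormedAddCommGroup F] [NormedSpace ℝ F]
  {E : M → Type*} [TopologicalSpace (TotalSpace F E)] [∀ m, AddCommGroup (E m)]
  [∀ m, Module ℝ (E m)] [∀ m, TopologicalSpace (E m)] [FiberBundle F E] [VectorBundle ℝ F E]
  [FiniteDimensional ℝ EM]

/-! The formula for `d_L ω_X` is a direct expansion. Once the Lie derivatives in the bracket are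
unfolded against a section of `𝔇E`, both sides become combinations of the same terms: operators of
`𝔇E` applied to pairings, and pairings with commutators. They agree after using the antisymmetry of
the commutator (`IsDirac.coboundaryFun_omega`).

Given the formula, `d_L ω_X = 0` says that `{X, l₁}` is orthogonal to every section of `L`, for all
`l₁`. If `X` normalizes `L`, this is isotropy. For the converse, sections of `L` fill each fibre
(`IsSubbundle.exists_section`), so `{X, l₁}` lies in the pointwise orthogonal of `L`, and it remains
to see that a maximal isotropic `W ⊂ 𝓔_m` contains its orthogonal (`mem_of_orthogonal`).

That is the real point, because the pairing is vector-valued and no dimension count is at hand. By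
maximality, a vector `v` orthogonal to `W` lies in `W` as soon as `⟨v, v⟩ = 0`. To get this, use `π
= baseProj : 𝓔_m → E_m ⊕ T_m M`. Its kernel is isotropic and contains the image of `Hom(E_m ⊕ T_m M,
E_m)` under `homIncl`, with `⟨Θ, v⟩ = ½ Θ(π v)`. If `π v = π w` with `w ∈ W`, then `v - w` is a null
vector and `⟨v, v⟩ = ⟨v - w, v - w⟩ = 0`. Otherwise some functional kills `π W` but not `π v`. The
corresponding rank-one `Θ` is then orthogonal to `W`, hence in `W`, and its orthogonality to `v`
forces `⟨v, v⟩ = 0`. -/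

/-! ### Bilinearity and symmetry of the fibrewise pairing. -/

theorem omniPair_add_left {m : M} (v v' w : OmniFib EM F E m) :
    omniPair (v + v') w = omniPair v w + omniPair v' w := by
  change (1 / 2 : ℝ) • (w.2.1 (v.1 + v'.1) + (v.2.1 w.1 + v'.2.1 w.1)) =
    (1 / 2 : ℝ) • (w.2.1 v.1 + v.2.1 w.1) + (1 / 2 : ℝ) • (w.2.1 v'.1 + v'.2.1 w.1)
  rw [map_add]
  module

theorem omniPair_smul_left {m : M} (r : ℝ) (v w : OmniFib EM F E m) :
    omniPair (r • v) w = r • omniPair v w := by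
  change (1 / 2 : ℝ) • (w.2.1 (r • v.1) + r • v.2.1 w.1) = r • (1 / 2 : ℝ) • (w.2.1 v.1 + v.2.1 w.1)
  rw [map_smul]
  module

theorem omniPair_comm {m : M} (v w : OmniFib EM F E m) : omniPair v w = omniPair w v :=
  congrArg ((1 / 2 : ℝ) • ·) (add_comm _ _)

/-- The fibrewise pairing as a bilinear map. -/
def omniBilin (m : M) : OmniFib EM F E m →ₗ[ℝ] OmniFib EM F E m →ₗ[ℝ] E m :=
  LinearMap.mk₂ ℝ omniPair omniPair_add_left omniPair_smul_left
    (fun v w w' => by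
      rw [omniPair_comm, omniPair_add_left, omniPair_comm w, omniPair_comm w'])
    (fun r v w => by rw [omniPair_comm, omniPair_smul_left, omniPair_comm w])

theorem omniBilin_apply {m : M} (v w : OmniFib EM F E m) : omniBilin m v w = omniPair v w := rfl

/-! ### The projection to `E_m ⊕ T_m M` and vectors in its kernel. -/

/-- The projection `𝓔_m → E_m ⊕ T_m M`, `d + μ ↦ (μ(1), α(d))`. -/
def baseProj (m : M) : OmniFib EM F E m →ₗ[ℝ] E m × TangentSpace 𝓘(ℝ, EM) m where
  toFun v := (v.2.1 (glIncl m LinearMap.id), v.1.symbol)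
  map_add' _ _ := rfl
  map_smul' _ _ := rfl

/-- The inclusion of `Hom(E_m ⊕ T_m M, E_m) = gl(E_m) ⊕ Hom(T_m M, E_m)` into `𝓔_m`. -/
def homIncl {m : M} (Θ : E m × TangentSpace 𝓘(ℝ, EM) m →ₗ[ℝ] E m) : OmniFib EM F E m :=
  (glIncl m (Θ ∘ₗ LinearMap.inl ℝ _ _),
    ⟨{ toFun := fun d => Θ (0, d.symbol)
       map_add' := fun d d' => by
        rw [← map_add, Prod.mk_add_mk, add_zero]
        rfl
       map_smul' := fun r d => by
        rw [RingHom.id_apply, ← map_smul, Prod.smul_mk, smul_zero]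
        -- Elements of `gl(E_m)` have symbol zero, so both sides of the jet condition come from `Θ
        -- (0, 0) = 0`.
        rfl }, fun Φ => (map_zero Θ).trans
          ((congrArg Φ (map_zero Θ)).trans (map_zero Φ)).symm⟩)

/-- Pairing with the image of `homIncl` sees a vector only through `baseProj`: the jet condition
turns `ν(Φ)` into `Φ(ν(1))`, so the `gl` part of `Θ` is evaluated at `ν(1)` and the other part at
the symbol. -/
theorem omniPair_homIncl {m : M} (Θ : E m × TangentSpace 𝓘(ℝ, EM) m →ₗ[ℝ] E m)
    (v : OmniFib EM F E m) : omniPair (homIncl Θ) v = (1 / 2 : ℝ) • Θ (baseProj m v) := by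
  have h : baseProj m v = (v.2.1 (glIncl m LinearMap.id), 0) + (0, v.1.symbol) := by
    rw [Prod.mk_add_mk, add_zero, zero_add]
    rfl
  change (1 / 2 : ℝ) • (v.2.1 (glIncl m (Θ ∘ₗ LinearMap.inl ℝ _ _)) + Θ (0, v.1.symbol)) = _
  rw [v.2.2, h, map_add]
  rfl

theorem baseProj_homIncl {m : M} (Θ : E m × TangentSpace 𝓘(ℝ, EM) m →ₗ[ℝ] E m) :
    baseProj (F := F) m (homIncl Θ) = 0 :=
  Prod.ext (map_zero Θ) rfl

/-- A null vector orthogonal to `W` can be adjoined: `W + ℝ v` is again isotropic, so maximality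
forces it to equal `W`. -/
theorem IsIsotropic.mem_of_maximal {m : M} {W : Submodule ℝ (OmniFib EM F E m)}
    (hW : Maximal IsIsotropic W) {v : OmniFib EM F E m} (hv : ∀ w ∈ W, omniPair v w = 0)
    (hvv : omniPair v v = 0) : v ∈ W := by
  refine hW.le_of_ge (y := W ⊔ ℝ ∙ v) ?_ le_sup_left
    (Submodule.mem_sup_right (Submodule.mem_span_singleton_self v))
  intro x hx y hy
  obtain ⟨w, hw, _, h, rfl⟩ := Submodule.mem_sup.1 hx
  obtain ⟨r, rfl⟩ := Submodule.mem_span_singleton.1 h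
  obtain ⟨w', hw', _, h', rfl⟩ := Submodule.mem_sup.1 hy
  obtain ⟨r', rfl⟩ := Submodule.mem_span_singleton.1 h'
  rw [← omniBilin_apply]
  simp only [map_add, map_smul, LinearMap.add_apply, LinearMap.smul_apply, omniBilin_apply]
  -- Of the four terms of `⟨w + r v, w' + r' v⟩`, the first dies by isotropy of `W`, the two mixed
  -- ones by orthogonality, and the last because `v` is null.
  rw [hW.prop w hw w' hw', hv w' hw', omniPair_comm w v, hv w hw, hvv]
  simp

/-! ### Identities for global sections. -/

theorem GammaOmni.sum_val {ι : Type*} (t : Finset ι) (s : ι → GammaOmni EM F E) (m : M) :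
    GammaOmni.val (∑ i ∈ t, s i) m = ∑ i ∈ t, (s i).val m := by
  classical
  induction t using Finset.induction_on with
  | empty => rfl
  | insert a t ha ih => rw [Finset.sum_insert ha, Finset.sum_insert ha, ← ih]; rfl

theorem omniPairSec_eq (X Y : GammaOmni EM F E) :
    omniPairSec X Y = (1 / 2 : ℝ) • (Y.2.pair X.1 + X.2.pair Y.1) := rfl

theorem GammaJ.pair_bracket_swap [T2Space M] (μ : GammaJ EM F E) (δ δ' : GammaD EM F E) :
    μ.pair (δ.bracket δ') = - μ.pair (δ'.bracket δ) := by
  rw [GammaD.bracket_swap]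
  ext m
  exact map_neg (μ.1 m).1 _

section

variable [T2Space M] [FiniteDimensional ℝ F] [ContMDiffVectorBundle ∞ F E 𝓘(ℝ, EM)]

/-! ### Orthogonals of maximal isotropic subspaces. -/

/-- Vanishing symbol makes the `𝔇E` component an endomorphism `Φ`, and then the jet condition gives
`ν(Φ) = Φ(ν(1)) = Φ(0) = 0`. -/
theorem omniPair_self_of_baseProj {m : M} {v : OmniFib EM F E m} (hv : baseProj m v = 0) :
    omniPair v v = 0 := by
  obtain ⟨Φ, hΦ⟩ := DFib.exists_gl v.1 (congrArg Prod.snd hv)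
  have h : v.2.1 v.1 = 0 := by
    rw [hΦ, v.2.2 Φ]
    exact (congrArg Φ (congrArg Prod.fst hv)).trans (map_zero Φ)
  change (1 / 2 : ℝ) • (v.2.1 v.1 + v.2.1 v.1) = 0
  rw [h, add_zero, smul_zero]

/-- A maximal isotropic subspace of a fibre of `𝓔` contains its orthogonal complement. -/
theorem mem_of_orthogonal {m : M} {W : Submodule ℝ (OmniFib EM F E m)}
    (hW : Maximal IsIsotropic W) {v : OmniFib EM F E m} (hv : ∀ w ∈ W, omniPair v w = 0) :
    v ∈ W := by
  refine IsIsotropic.mem_of_maximal hW hv ?_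
  have hπ : baseProj m v ∈ W.map (baseProj m) ∨ omniPair v v = 0 := by
    by_contra! h
    obtain ⟨φ, hφ, hker⟩ := Submodule.exists_le_ker_of_notMem h.1
    -- The rank-one map `φ ⊗ ⟨v, v⟩`. Its direction in `E_m` only has to be nonzero, and `⟨v, v⟩` is
    -- nonzero by the assumption being refuted.
    let Θ := φ.smulRight (omniPair v v)
    have hk : homIncl Θ ∈ W := by
      refine IsIsotropic.mem_of_maximal hW (fun w hw => ?_)
        (omniPair_self_of_baseProj (baseProj_homIncl Θ))
      have h0 : φ (baseProj m w) = 0 := hker (Submodule.mem_map_of_mem hw)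
      rw [omniPair_homIncl, LinearMap.smulRight_apply, h0, zero_smul, smul_zero]
    -- Since `homIncl Θ` lies in `W`, it is orthogonal to `v`, that is `½ φ(π v) ⟨v, v⟩ = 0`,
    -- although both factors are nonzero.
    have h0 := hv _ hk
    rw [omniPair_comm, omniPair_homIncl, LinearMap.smulRight_apply] at h0
    simp only [smul_eq_zero, hφ, h.2, or_false] at h0
    norm_num at h0
  obtain ⟨w, hw, hwv⟩ | h := hπ
  -- Here `v - w` is in the kernel of `baseProj`, hence null. Expanding, every term except `⟨v, v⟩`
  -- vanishes.
  · have h1 : omniPair (v - w) (v - w) = 0 :=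
      omniPair_self_of_baseProj (by rw [map_sub, hwv, sub_self])
    rw [← omniBilin_apply] at h1
    simp only [map_sub, LinearMap.sub_apply, omniBilin_apply] at h1
    rw [hW.prop w hw w hw, hv w hw, omniPair_comm w v, hv w hw] at h1
    simpa using h1
  · exact h

/-! ### Sections of `L` and the coboundary of `ω_X`. -/

/-- Every vector in a fibre of a subbundle is the value of a global smooth section. -/
theorem IsSubbundle.exists_section {L : ∀ m : M, Submodule ℝ (OmniFib EM F E m)}
    (hL : IsSubbundle L) {m : M} {w : OmniFib EM F E m} (hw : w ∈ L m) :
    ∃ l : GammaSub L, l.1.val m = w := by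
  obtain ⟨k, s, hs⟩ := hL m
  obtain ⟨χ, hχ, hχ1⟩ := exists_bump (EM := EM) hs
  have h1 : χ m = 1 := hχ1.self_of_nhds
  rw [← hs.self_of_nhds.2] at hw
  -- Constant coefficients suffice: only the value at `m` is prescribed, and the cutoff `χ` makes
  -- the section globally `L`-valued.
  obtain ⟨c, rfl⟩ := (Submodule.mem_span_range_iff_exists_fun ℝ).1 hw
  have hval (p : M) : GammaOmni.val (χ • ∑ i, c i • s i) p =
      χ p • ∑ i, c i • (s i).val p := by
    change χ p • GammaOmni.val (∑ i, c i • s i) p = _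
    rw [GammaOmni.sum_val]
    rfl
  refine ⟨⟨χ • ∑ i, c i • s i, fun p => ?_⟩, (hval m).trans (by rw [h1, one_smul])⟩
  rw [hval]
  -- Off the support of `χ` the value is zero. On it, `p` lies in the neighbourhood where the `s i`
  -- span `L p`.
  by_cases h0 : χ p = 0
  · rw [h0, zero_smul]
    exact (L p).zero_mem
  · rw [← (hχ (subset_tsupport _ h0)).2]
    exact Submodule.smul_mem _ _ (Submodule.sum_mem _ fun i _ =>
      Submodule.smul_mem _ _ (Submodule.subset_span ⟨i, rfl⟩))

/-- A formal identity among sections of `𝓔`: the closedness of `L` serves to make `{l₁, l₂}` an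
admissible argument of `ω_X`. In `⟨X, {l₁, l₂}⟩` the terms where `l₁` or `l₂` differentiates a
pairing with the `𝔇E` part of `X` cancel against those of the first two summands. -/
theorem IsDirac.coboundaryFun_omega {L : ∀ m : M, Submodule ℝ (OmniFib EM F E m)}
    (hL : IsDirac L) (X : GammaOmni EM F E) (l₁ l₂ : GammaSub L) :
    hL.coboundaryFun (omega L X) l₁ l₂ = - omniPairSec (dorfman X l₁.1) l₂.1 := by
  change l₁.1.1.op (omniPairSec X l₂.1) - l₂.1.1.op (omniPairSec X l₁.1) -
    omniPairSec X (dorfman l₁.1 l₂.1) = _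
  have h (Y Z : GammaOmni EM F E) : (dorfman Y Z).1 = Y.1.bracket Z.1 := rfl
  simp only [omniPairSec_eq, map_smul, map_add, dorfman_pair, h]
  -- After expansion the left side contains commutators `[lᵢ, X]` of `𝔇E` components and the right
  -- side `[X, lᵢ]`. Reorienting the former leaves a linear identity.
  rw [GammaJ.pair_bracket_swap l₂.1.2 l₁.1.1 X.1, GammaJ.pair_bracket_swap l₁.1.2 l₂.1.1 X.1]
  module

end

end OmniLie

end

/-! ### The proposition. -/

theorem proposition6p1
    {EM : Type*} [NormedAddCommGroup EM] [NormedSpace ℝ EM] [FiniteDimensional ℝ EM]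
    {M : Type*} [TopologicalSpace M] [ChartedSpace EM M] [IsManifold 𝓘(ℝ, EM) ∞ M] [T2Space M]
    {F : Type*} [NormedAddCommGroup F] [NormedSpace ℝ F] [FiniteDimensional ℝ F] [Nontrivial F]
    {E : M → Type*} [TopologicalSpace (TotalSpace F E)] [∀ m, AddCommGroup (E m)]
    [∀ m, Module ℝ (E m)] [∀ m, TopologicalSpace (E m)] [FiberBundle F E] [VectorBundle ℝ F E]
    [ContMDiffVectorBundle ∞ F E 𝓘(ℝ, EM)]
    (L : ∀ m : M, Submodule ℝ (OmniFib EM F E m)) (hL : IsDirac L) (X : GammaOmni EM F E) :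
    (∀ l₁ l₂ : GammaSub L,
      (hL.dL (omega L X)).1 l₁ l₂ = - omniPairSec (dorfman X l₁.1) l₂.1) ∧
    (X ∈ normalizer L ↔ hL.dL (omega L X) = 0) := by
  refine ⟨fun l₁ l₂ => hL.coboundaryFun_omega X l₁ l₂, fun hX => ?_, fun h Y hY m => ?_⟩
  · refine Subtype.ext (LinearMap.ext fun l₁ => LinearMap.ext fun l₂ => ?_)
    refine (hL.coboundaryFun_omega X l₁ l₂).trans (neg_eq_zero.2 ?_)
    ext m
    -- `{X, l₁}` and `l₂` both take values in the isotropic `L m`.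
    exact (hL.maximal m).prop _ (hX l₁.1 l₁.2 m) _ (l₂.2 m)
  -- Membership in `L m` is reduced to orthogonality against each `w ∈ L m`. Extending `w` to a
  -- section `l` of `L` allows the vanishing of `d_L ω_X` on `(Y, l)` to be evaluated at `m`.
  · refine mem_of_orthogonal (hL.maximal m) fun w hw => ?_
    obtain ⟨l, rfl⟩ := hL.subbundle.exists_section hw
    have h0 : - omniPairSec (dorfman X Y) l.1 = 0 :=
      (hL.coboundaryFun_omega X ⟨Y, hY⟩ l).symm.trans (by
        change (hL.dL (omega L X)).1 ⟨Y, hY⟩ l = 0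
        rw [h]
        rfl)
    exact DFunLike.congr_fun (neg_eq_zero.1 h0) m
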